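/- **Theorem.** Let $T_1$ be the tree consisting of the single vertex $1$ and, for $n\ge 2$, let $T_n$ be obtained from $T_{n-1}$ by adding a vertex $n$ and an edge directed from $n$ to a vertex of $\{1,\dots,n-1\}$ chosen uniformly at random, the choices for different $n$ being independent (so $T_n$ is the random recursive tree of size $n$, with root $1$). The degree of a vertex is the number of edges directed towards it. Let $D=D(n)$ be the degree of the root of $T_n$, and let $Z_{\ge D}$ be the number of vertices of $T_n$ whose degree in $T_n$ is at least $D$. Then, as $n\to\infty$, $$\frac{\ln (Z_{\ge D})}{\ln n}\longrightarrow 1-\ln 2\quad\text{in probability.}$$ -/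

import Mathlib

open MeasureTheory ProbabilityTheory Filter Topology

/-- A finite directed graph whose vertices are labelled by natural numbers; the pair `(u, v)` is the
edge directed from `u` to `v`. In a rooted tree, edges are directed towards the root. -/
@[ext]
structure LabelledDigraph where
  /-- the vertices -/
  verts : Finset ℕ
  /-- the directed edges -/
  edges : Finset (ℕ × ℕ)

namespace LabelledDigraph

/-- The graph with the single vertex `v` and no edge. -/
def single (v : ℕ) : LabelledDigraph where
  verts := {v}
  edges := ∅

/-- Add a new vertex `u` together with an edge directed from `u` to `v`. -/
def attach (T : LabelledDigraph) (u v : ℕ) : LabelledDigraph where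
  verts := insert u T.verts
  edges := insert (u, v) T.edges

/-- The degree of `v` in `T`: the number of edges directed towards `v`. -/
def degree (T : LabelledDigraph) (v : ℕ) : ℕ :=
  (T.edges.filter fun e => e.2 = v).card

/-- The number `Z_{≥ d}` of vertices of `T` of degree at least `d`. -/
def numDegreeGE (T : LabelledDigraph) (d : ℕ) : ℕ :=
  (T.verts.filter fun v => d ≤ T.degree v).card

end LabelledDigraph

/-- The recursive trees grown from the sequence of choices `p`: `T₁` is the single vertex `1` (the
root), and `Tₙ` is obtained from `Tₙ₋₁` by adding the vertex `n` and an edge from `n` to `p n`.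
The index `0`, at which there is no tree, receives the empty graph. -/
def recursiveTree (p : ℕ → ℕ) : ℕ → LabelledDigraph
  | 0 => ⟨∅, ∅⟩
  | 1 => LabelledDigraph.single 1
  | n + 2 => (recursiveTree p (n + 1)).attach (n + 2) (p (n + 2))

/-- The choices that grow a random recursive tree: for every `n ≥ 2` the vertex `P n` is uniformly
distributed on `{1, …, n - 1}`, and the `P n`, `n ≥ 2`, are independent. (The values `P 0` and `P 1`
are never used.) -/
structure IsRecursiveChoice {Ω : Type*} [MeasurableSpace Ω] (P : ℕ → Ω → ℕ) (μ : Measure Ω) :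
    Prop where
  hasLaw : ∀ n, 2 ≤ n → HasLaw (P n) (uniformOn (Set.Ico 1 n)) μ
  indep : iIndepFun (fun n : {n : ℕ // 2 ≤ n} => P n) μ

/-! The root degree is a sum of independent Bernoulli variables with mean and variance about `ln n`,
so by Chebyshev (`measure_root_le`) it lies within `δ ln n` of `ln n` with high probability. Since
`Z_{≥ d}` decreases in `d`, it suffices to bound it above at `d = (1 - δ) ln n` and below at `d = (1
+ δ) ln n`.

Upper bound: `2 ^ deg v` has mean `n / v`, so `2 ^ d * Z_{≥ d}` has mean at most `n (1 + ln n)`, and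
Markov's inequality (`measure_numDegreeGE_ge_le`) gives `Z_{≥ d} ≤ n ^ (1 - ln 2 + o(1))`.

Lower bound: tilting by `2` turns the in-degree of `v` into a Poisson binomial variable with mean
about `2 ln (n / v)`, which equals `ln n` at `v = n ^ (1/2)`. Labels up to `M`, slightly below `n ^
(1/2)`, therefore already produce enough vertices of degree `d`: the tail bound `indegree_tail_ge`
makes their expected number `n ^ (1 - ln 2 - o(1))`. In-degrees of distinct vertices are negatively
correlated under increasing functions (`integral_indegree_mul_le`), so the second moment method
(`measure_numDegreeGE_le`) applies. -/

/-- The number of choices `p k`, `M < k ≤ n`, that are equal to `v`. -/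
def indegree (p : ℕ → ℕ) (M n v : ℕ) : ℕ :=
  ((Finset.Ioc M n).filter fun k => p k = v).card

/-! ### Degrees in the tree as counts of choices -/

theorem indegree_self (p : ℕ → ℕ) (M v : ℕ) : indegree p M M v = 0 := by
  simp [indegree]

theorem indegree_succ (p : ℕ → ℕ) {M n : ℕ} (h : M ≤ n) (v : ℕ) :
    indegree p M (n + 1) v = indegree p M n v + if p (n + 1) = v then 1 else 0 := by
  have : Finset.Ioc M (n + 1) = insert (n + 1) (Finset.Ioc M n) := by
    ext k; simp only [Finset.mem_Ioc, Finset.mem_insert]; omega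
  rw [indegree, this, Finset.filter_insert]
  split_ifs
  · rw [Finset.card_insert_of_notMem (by simp)]; rfl
  · rfl

theorem indegree_le (p : ℕ → ℕ) (M n v : ℕ) : indegree p M n v ≤ n := by
  refine (Finset.card_filter_le _ _).trans ?_
  simp

theorem indegree_congr {p q : ℕ → ℕ} {M n : ℕ} (h : ∀ k, M < k → k ≤ n → p k = q k) (v : ℕ) :
    indegree p M n v = indegree q M n v := by
  unfold indegree
  congr 1
  refine Finset.filter_congr fun k hk => ?_
  rw [Finset.mem_Ioc] at hk
  rw [h k hk.1 hk.2]

theorem indegree_anti (p : ℕ → ℕ) {M N : ℕ} (h : N ≤ M) (n v : ℕ) :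
    indegree p M n v ≤ indegree p N n v :=
  Finset.card_le_card (Finset.filter_subset_filter _ (Finset.Ioc_subset_Ioc_left h))

/-- A vertex receives no edge from vertices with a smaller label. -/
theorem indegree_one_eq {p : ℕ → ℕ} (hp : ∀ k, 2 ≤ k → p k < k) {v : ℕ} (hv : 1 ≤ v) (n : ℕ) :
    indegree p 1 n v = indegree p v n v := by
  unfold indegree
  congr 1
  ext k
  simp only [Finset.mem_filter, Finset.mem_Ioc]
  constructor
  · rintro ⟨⟨h1, h2⟩, rfl⟩
    exact ⟨⟨hp k h1, h2⟩, rfl⟩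
  · rintro ⟨⟨h1, h2⟩, h3⟩
    exact ⟨⟨by omega, h2⟩, h3⟩

theorem recursiveTree_edges (p : ℕ → ℕ) (n : ℕ) :
    (recursiveTree p n).edges = (Finset.Ioc 1 n).image fun k => (k, p k) := by
  induction n using recursiveTree.induct with
  | case1 => rfl
  | case2 => rfl
  | case3 n ih =>
    have : Finset.Ioc 1 (n + 2) = insert (n + 2) (Finset.Ioc 1 (n + 1)) := by
      ext k; simp only [Finset.mem_Ioc, Finset.mem_insert]; omega
    rw [recursiveTree, LabelledDigraph.attach, ih, this, Finset.image_insert]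

theorem recursiveTree_verts (p : ℕ → ℕ) (n : ℕ) :
    (recursiveTree p n).verts = Finset.Icc 1 n := by
  induction n using recursiveTree.induct with
  | case1 => rfl
  | case2 => rfl
  | case3 n ih =>
    have : Finset.Icc 1 (n + 2) = insert (n + 2) (Finset.Icc 1 (n + 1)) := by
      ext k; simp only [Finset.mem_Icc, Finset.mem_insert]; omega
    rw [recursiveTree, LabelledDigraph.attach, ih, this]

theorem recursiveTree_degree (p : ℕ → ℕ) (n v : ℕ) :
    (recursiveTree p n).degree v = indegree p 1 n v := by
  rw [LabelledDigraph.degree, recursiveTree_edges, Finset.filter_image,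
    Finset.card_image_of_injective _ fun a b h => (Prod.ext_iff.1 h).1]
  rfl

theorem recursiveTree_numDegreeGE (p : ℕ → ℕ) (n d : ℕ) :
    (recursiveTree p n).numDegreeGE d =
      ((Finset.Icc 1 n).filter fun v => d ≤ indegree p 1 n v).card := by
  simp only [LabelledDigraph.numDegreeGE, recursiveTree_verts, recursiveTree_degree]

theorem LabelledDigraph.numDegreeGE_anti (T : LabelledDigraph) : Antitone T.numDegreeGE :=
  fun _ _ h => Finset.card_le_card
    (Finset.monotone_filter_right _ fun _ _ hv => h.trans hv)

theorem recursiveTree_congr {p q : ℕ → ℕ} (h : ∀ k, 2 ≤ k → p k = q k) (n : ℕ) :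
    recursiveTree p n = recursiveTree q n := by
  induction n using recursiveTree.induct with
  | case1 => rfl
  | case2 => rfl
  | case3 n ih => rw [recursiveTree, recursiveTree, ih, h _ (by omega)]

/-! ### Poisson binomial laws and their exponential tilts -/

/-- The expectation of `f S`, where `S` is a sum of independent Bernoulli variables with parameters
`p 0, …, p (j - 1)`. -/
noncomputable def poissonBinomialExp (p : ℕ → ℝ) : ℕ → (ℕ → ℝ) → ℝ
  | 0, f => f 0
  | j + 1, f => poissonBinomialExp p j fun s => (1 - p j) * f s + p j * f (s + 1)

namespace poissonBinomialExp

variable {p : ℕ → ℝ}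

theorem linear (j : ℕ) (f g : ℕ → ℝ) (a b : ℝ) :
    poissonBinomialExp p j (fun s => a * f s + b * g s) =
      a * poissonBinomialExp p j f + b * poissonBinomialExp p j g := by
  induction j generalizing f g with
  | zero => rfl
  | succ j ih =>
    simp only [poissonBinomialExp]
    rw [← ih]
    congr 1
    ext s
    ring

theorem mono (h0 : ∀ i, 0 ≤ p i) (h1 : ∀ i, p i ≤ 1) (j : ℕ) {f g : ℕ → ℝ} (h : ∀ s, f s ≤ g s) :
    poissonBinomialExp p j f ≤ poissonBinomialExp p j g := by
  induction j generalizing f g with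
  | zero => exact h 0
  | succ j ih =>
    exact ih fun s => add_le_add (mul_le_mul_of_nonneg_left (h s) (sub_nonneg.2 (h1 j)))
      (mul_le_mul_of_nonneg_left (h _) (h0 j))

/-- The exponentially tilted total mass of a Poisson binomial law. -/
theorem tilt (j : ℕ) (t : ℝ) :
    poissonBinomialExp p j (fun s => t ^ s) = ∏ i ∈ Finset.range j, (1 - p i + p i * t) := by
  induction j with
  | zero => simp [poissonBinomialExp]
  | succ j ih =>
    rw [Finset.prod_range_succ, ← ih, poissonBinomialExp]
    have := linear (p := p) j (fun s => t ^ s) (fun _ => 0) (1 - p j + p j * t) 0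
    simp only [mul_zero, zero_mul, add_zero] at this
    rw [mul_comm, ← this]
    congr 1
    ext s
    ring

/-- An exponentially tilted Poisson binomial law is again Poisson binomial; this gives its
second moment around `a`. -/
theorem tilt_sq {t : ℝ} {r : ℕ → ℝ} (hr : ∀ i, (1 - p i + p i * t) * r i = p i * t)
    (j : ℕ) (a : ℝ) :
    poissonBinomialExp p j (fun s => t ^ s * (s - a) ^ 2) =
      (∏ i ∈ Finset.range j, (1 - p i + p i * t)) *
        (∑ i ∈ Finset.range j, r i * (1 - r i) + (∑ i ∈ Finset.range j, r i - a) ^ 2) := by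
  induction j generalizing a with
  | zero => simp [poissonBinomialExp]
  | succ j ih =>
    rw [Finset.prod_range_succ, Finset.sum_range_succ, Finset.sum_range_succ, poissonBinomialExp]
    -- A success in the last trial contributes a factor `t` and moves the centre from `a` to `a -
    -- 1`, hence the induction over all centres.
    have := linear (p := p) j (fun s => t ^ s * (s - a) ^ 2) (fun s => t ^ s * (s - (a - 1)) ^ 2)
      (1 - p j) (p j * t)
    rw [ih, ih] at this
    have h2 : (fun s : ℕ => (1 - p j) * (t ^ s * ((s : ℝ) - a) ^ 2) +
        p j * (t ^ (s + 1) * (((s + 1 : ℕ) : ℝ) - a) ^ 2)) =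
        fun s : ℕ => (1 - p j) * (t ^ s * ((s : ℝ) - a) ^ 2) +
          p j * t * (t ^ s * ((s : ℝ) - (a - 1)) ^ 2) := by
      ext s
      push_cast
      ring
    rw [h2, this]
    have h3 := hr j
    generalize ∏ i ∈ Finset.range j, (1 - p i + p i * t) = C
    generalize ∑ i ∈ Finset.range j, r i * (1 - r i) = V
    generalize ∑ i ∈ Finset.range j, r i = m
    linear_combination (-C * (2 * (m - a) + 1)) * h3

end poissonBinomialExp

/-! ### Harmonic sums against logarithms -/

theorem harmonic_sum_le_log {M : ℕ} (hM : 1 ≤ M) (j : ℕ) :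
    ∑ i ∈ Finset.range j, 1 / ((M : ℝ) + i + 1) ≤ Real.log (((M : ℝ) + j) / M) := by
  have hM' : (1 : ℝ) ≤ M := by exact_mod_cast hM
  induction j with
  | zero => simp [show (M : ℝ) ≠ 0 by linarith]
  | succ j ih =>
    rw [Finset.sum_range_succ]
    have h : 1 / ((M : ℝ) + j + 1) ≤ Real.log (((M : ℝ) + j + 1) / (M + j)) := by
      have h0 : 0 < ((M : ℝ) + j + 1) / (M + j) := by positivity
      have := Real.one_sub_inv_le_log_of_pos h0
      refine le_trans (le_of_eq ?_) this
      field_simp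
      ring
    rw [Real.log_div (by positivity) (by positivity)] at *
    push_cast
    rw [← add_assoc]
    linarith

theorem log_le_harmonic_sum {M : ℕ} (hM : 1 ≤ M) (j : ℕ) :
    Real.log (((M : ℝ) + j) / M) ≤ ∑ i ∈ Finset.range j, 1 / ((M : ℝ) + i) := by
  have hM' : (1 : ℝ) ≤ M := by exact_mod_cast hM
  induction j with
  | zero => simp [show (M : ℝ) ≠ 0 by linarith]
  | succ j ih =>
    rw [Finset.sum_range_succ]
    have h : Real.log (((M : ℝ) + j + 1) / (M + j)) ≤ 1 / ((M : ℝ) + j) := by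
      have h0 : 0 < ((M : ℝ) + j + 1) / (M + j) := by positivity
      refine (Real.log_le_sub_one_of_pos h0).trans (le_of_eq ?_)
      field_simp
      ring
    rw [Real.log_div (by positivity) (by positivity)] at *
    push_cast
    rw [← add_assoc]
    linarith

theorem integrable_comp_of_finite_range {Ω β : Type*} [MeasurableSpace Ω] {μ : Measure Ω}
    [IsFiniteMeasure μ] [MeasurableSpace β] [Countable β] [MeasurableSingletonClass β]
    {X : Ω → β} (hX : Measurable X) (hfin : (Set.range X).Finite) (f : β → ℝ) :
    Integrable (fun ω => f (X ω)) μ := by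
  obtain ⟨C, hC⟩ := (hfin.image fun x => ‖f x‖).bddAbove
  refine Integrable.of_bound (((measurable_of_countable f).comp hX).aestronglyMeasurable) C
    (Eventually.of_forall fun ω => hC ?_)
  exact ⟨X ω, ⟨ω, rfl⟩, rfl⟩

/-! ### Replacing the choices by everywhere valid versions -/

/-- Choices of parents that are measurable, valid everywhere, uniform and independent. -/
structure IsUniformParent {Ω : Type*} [MeasurableSpace Ω] (Q : ℕ → Ω → ℕ) (μ : Measure Ω) :
    Prop where
  measurable : ∀ n, Measurable (Q n)
  mem : ∀ n, 2 ≤ n → ∀ ω, Q n ω ∈ Finset.Ico 1 n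
  prob : ∀ n, 1 ≤ n → ∀ i ∈ Finset.Ico 1 (n + 1), μ.real {ω | Q (n + 1) ω = i} = 1 / (n : ℝ)
  indep : iIndepFun (fun n : ℕ => Q (n + 2)) μ

/-- The given choices are only a.e. measurable and a.s. in range. Modifying them on a null set
removes both defects and changes the trees only on a null set. -/
theorem IsRecursiveChoice.exists_isUniformParent {Ω : Type*} [MeasurableSpace Ω] {μ : Measure Ω}
    {P : ℕ → Ω → ℕ} (hP : IsRecursiveChoice P μ) :
    ∃ Q : ℕ → Ω → ℕ, IsUniformParent Q μ ∧ ∀ᵐ ω ∂μ, ∀ n, 2 ≤ n → P n ω = Q n ω := by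
  classical
  let R : ℕ → Ω → ℕ := fun n => if h : 2 ≤ n then (hP.hasLaw n h).aemeasurable.mk else fun _ => 1
  have hR : ∀ n, Measurable (R n) := by
    intro n
    by_cases h : 2 ≤ n
    · simpa [R, h] using (hP.hasLaw n h).aemeasurable.measurable_mk
    · simp [R, h]
  have hPR : ∀ n, 2 ≤ n → P n =ᵐ[μ] R n := by
    intro n h
    simpa [R, h] using (hP.hasLaw n h).aemeasurable.ae_eq_mk
  -- The fallback value `1` is a legal parent for every `n ≥ 2`.
  let Q : ℕ → Ω → ℕ := fun n ω => if R n ω ∈ Finset.Ico 1 n then R n ω else 1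
  have hQ : ∀ n, Measurable (Q n) := fun n =>
    (measurable_of_countable fun k : ℕ => if k ∈ Finset.Ico 1 n then k else 1).comp (hR n)
  have hmap : ∀ n, 2 ≤ n → ∀ s : Set ℕ, μ (P n ⁻¹' s) = uniformOn (Set.Ico 1 n) s := by
    intro n h s
    rw [← (hP.hasLaw n h).map_eq,
      Measure.map_apply_of_aemeasurable (hP.hasLaw n h).aemeasurable (MeasurableSet.of_discrete)]
  have hPQ : ∀ n, 2 ≤ n → P n =ᵐ[μ] Q n := by
    intro n h
    have h1 : ∀ᵐ ω ∂μ, P n ω ∈ Finset.Ico 1 n := by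
      rw [ae_iff]
      have := hmap n h {k | k ∉ Finset.Ico 1 n}
      rw [Set.preimage_ofPred_eq] at this
      rw [this, uniformOn_eq_zero_iff (Set.finite_Ico 1 n)]
      ext k
      simp
    filter_upwards [h1, hPR n h] with ω h2 h3
    rw [h3] at h2
    simp only [Q, if_pos h2, h3]
  refine ⟨Q, ⟨hQ, ?_, ?_, ?_⟩, ?_⟩
  · intro n h ω
    simp only [Q]
    split_ifs with h'
    · exact h'
    · simp; omega
  · intro n h i hi
    have h1 : μ {ω | Q (n + 1) ω = i} = μ (P (n + 1) ⁻¹' {i}) := by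
      refine measure_congr ?_
      filter_upwards [hPQ (n + 1) (by omega)] with ω hω
      have : P (n + 1) ω = i ↔ Q (n + 1) ω = i := by rw [hω]
      exact propext this.symm
    rw [measureReal_def, h1, hmap _ (by omega)]
    have h2 := uniformOn_apply_finset (s := Finset.Ico 1 (n + 1)) (t := {i})
    rw [Finset.coe_Ico, Finset.coe_singleton] at h2
    rw [h2, Finset.inter_singleton_of_mem hi]
    simp
  · have h1 := hP.indep.precomp (g := fun n : ℕ => (⟨n + 2, by omega⟩ : {n : ℕ // 2 ≤ n}))
      (fun a b hab => by simpa using hab)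
    exact h1.congr fun i => hPQ (i + 2) (by omega)
  · rw [ae_all_iff]
    intro n
    by_cases h : 2 ≤ n
    · filter_upwards [hPQ n h] with ω hω _ using hω
    · exact Eventually.of_forall fun ω h' => absurd h' h

/-! ### Law and negative dependence of in-degrees -/

namespace IsUniformParent

variable {Ω : Type*} [MeasurableSpace Ω] {μ : Measure Ω} [IsProbabilityMeasure μ]
  {Q : ℕ → Ω → ℕ}

omit [IsProbabilityMeasure μ] in
theorem measurable_indegree (hQ : IsUniformParent Q μ) (M n v : ℕ) :
    Measurable fun ω => indegree (Q · ω) M n v := by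
  have : (fun ω => indegree (Q · ω) M n v) =
      fun ω => ∑ k ∈ Finset.Ioc M n, (fun i : ℕ => if i = v then 1 else 0) (Q k ω) := by
    ext ω
    simp [indegree]
  rw [this]
  exact Finset.measurable_sum _ fun k _ =>
    (measurable_of_countable fun i : ℕ => if i = v then 1 else 0).comp (hQ.measurable k)

omit [IsProbabilityMeasure μ] in
/-- What is determined by the first choices is independent of the next choice. -/
theorem indepFun_next (hQ : IsUniformParent Q μ) {β : Type*} [MeasurableSpace β] {n : ℕ}
    (hn : 1 ≤ n) (F : (ℕ → ℕ) → β)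
    (hF : ∀ p q : ℕ → ℕ, (∀ k, 1 < k → k ≤ n → p k = q k) → F p = F q) :
    IndepFun (fun ω => F (Q · ω)) (Q (n + 1)) μ := by
  -- Index `i` stands for the choice of vertex `i + 2`: the choices of `2, …, n` have indices below
  -- `n - 1`, and that of `n + 1` has index `n - 1`.
  have h := hQ.indep.indepFun_finset (Finset.range (n - 1)) {n - 1} (by simp)
    fun i => hQ.measurable _
  let φ : (Finset.range (n - 1) → ℕ) → β := fun t =>
    F fun k => if h : k - 2 ∈ Finset.range (n - 1) then t ⟨k - 2, h⟩ else 0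
  let ψ : (({n - 1} : Finset ℕ) → ℕ) → ℕ := fun t => t ⟨n - 1, by simp⟩
  have h1 := h.comp (φ := φ) (ψ := ψ) (measurable_of_countable φ) (measurable_of_countable ψ)
  convert h1 using 1
  · ext1 ω
    refine hF _ _ fun k hk hkn => ?_
    have : k - 2 ∈ Finset.range (n - 1) := by rw [Finset.mem_range]; omega
    rw [dif_pos this]
    have : k - 2 + 2 = k := by omega
    simp only [this]
  · ext1 ω
    have : n - 1 + 2 = n + 1 := by omega
    simp [ψ, this]

/-- Averaging over the next choice. -/
theorem integral_next (hQ : IsUniformParent Q μ) {β : Type*} [MeasurableSpace β] [Countable β]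
    [MeasurableSingletonClass β] {n : ℕ} (hn : 1 ≤ n) {X : Ω → β} (hX : Measurable X)
    (hfin : (Set.range X).Finite) (hind : IndepFun X (Q (n + 1)) μ) (f : β → ℕ → ℝ) :
    ∫ ω, f (X ω) (Q (n + 1) ω) ∂μ =
      ∫ ω, (1 / (n : ℝ)) * ∑ i ∈ Finset.Ico 1 (n + 1), f (X ω) i ∂μ := by
  have h1 : ∀ ω, f (X ω) (Q (n + 1) ω) = ∑ i ∈ Finset.Ico 1 (n + 1),
      f (X ω) i * (if Q (n + 1) ω = i then 1 else 0) := by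
    intro ω
    have := hQ.mem (n + 1) (by omega) ω
    simp only [mul_ite, mul_one, mul_zero, Finset.sum_ite_eq, if_pos this]
  have hQm := hQ.measurable (n + 1)
  have hi : ∀ i, Integrable (fun ω => f (X ω) i) μ := fun i =>
    integrable_comp_of_finite_range hX hfin fun x => f x i
  have hm : ∀ i, AEStronglyMeasurable (fun ω => if Q (n + 1) ω = i then (1 : ℝ) else 0) μ :=
    fun i => ((measurable_of_countable fun k : ℕ => if k = i then (1 : ℝ) else 0).comp
      hQm).aestronglyMeasurable
  simp only [h1]
  rw [integral_finsetSum, integral_const_mul, integral_finsetSum, Finset.mul_sum]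
  · refine Finset.sum_congr rfl fun i hi' => ?_
    have h2 : IndepFun (fun ω => f (X ω) i) (fun ω => if Q (n + 1) ω = i then (1 : ℝ) else 0) μ :=
      hind.comp (φ := fun x => f x i) (ψ := fun k : ℕ => if k = i then (1 : ℝ) else 0)
        (measurable_of_countable _) (measurable_of_countable _)
    rw [h2.integral_fun_mul_eq_mul_integral (hi i).aestronglyMeasurable (hm i), mul_comm]
    congr 1
    have h3 : (fun ω => if Q (n + 1) ω = i then (1 : ℝ) else 0) =
        Set.indicator (Q (n + 1) ⁻¹' {i}) 1 := by
      ext ω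
      by_cases h : Q (n + 1) ω = i
      · rw [if_pos h, Set.indicator_of_mem (by exact h)]; rfl
      · rw [if_neg h, Set.indicator_of_notMem (by exact h)]
    rw [h3, integral_indicator_one (hQm (measurableSet_singleton i))]
    exact hQ.prob n hn i hi'
  · exact fun i _ => hi i
  · intro i _
    refine (hi i).mul_of_top_left (memLp_top_of_bound (hm i) 1 (Eventually.of_forall fun ω => ?_))
    split_ifs <;> simp

theorem average_single {n v : ℕ} (hv : 1 ≤ v) (hvn : v ≤ n) (f : ℕ → ℝ) (s : ℕ) :
    1 / (n : ℝ) * ∑ i ∈ Finset.Ico 1 (n + 1), f (s + if i = v then 1 else 0) =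
      (1 - 1 / (n : ℝ)) * f s + 1 / (n : ℝ) * f (s + 1) := by
  have hn : (n : ℝ) ≠ 0 := by
    have : 0 < n := by omega
    positivity
  have h1 : ∀ i, f (s + if i = v then 1 else 0) =
      f s + if i = v then f (s + 1) - f s else 0 := by
    intro i
    split_ifs <;> simp
  simp only [h1, Finset.sum_add_distrib, Finset.sum_ite_eq', Finset.sum_const, Nat.card_Ico]
  rw [if_pos (by simp; omega)]
  simp only [Nat.add_sub_cancel, nsmul_eq_mul]
  field_simp
  ring

/-- One choice cannot hit both `v` and `w`, so the left side lacks the cross term `(f (s + 1) - f s)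
* (g (t + 1) - g t) / n ^ 2`, which is nonnegative by monotonicity. -/
theorem average_pair_le {n v w : ℕ} (hv : 1 ≤ v) (hvn : v ≤ n) (hw : 1 ≤ w) (hwn : w ≤ n)
    (hvw : v ≠ w) {f g : ℕ → ℝ} (hf : Monotone f) (hg : Monotone g) (s t : ℕ) :
    1 / (n : ℝ) * ∑ i ∈ Finset.Ico 1 (n + 1),
        (f (s + if i = v then 1 else 0) * g (t + if i = w then 1 else 0)) ≤
      ((1 - 1 / (n : ℝ)) * f s + 1 / (n : ℝ) * f (s + 1)) *
        ((1 - 1 / (n : ℝ)) * g t + 1 / (n : ℝ) * g (t + 1)) := by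
  have hn : (n : ℝ) ≠ 0 := by
    have : 0 < n := by omega
    positivity
  have h1 : ∀ i, f (s + if i = v then 1 else 0) * g (t + if i = w then 1 else 0) =
      f s * g t + (if i = v then (f (s + 1) - f s) * g t else 0) +
        (if i = w then f s * (g (t + 1) - g t) else 0) := by
    intro i
    by_cases h : i = v
    · have : i ≠ w := fun h' => hvw (h.symm.trans h')
      simp only [if_pos h, if_neg this]
      simp only [add_zero]
      ring
    · simp only [if_neg h]
      split_ifs
      · simp only [add_zero]
        ring
      · simp
  simp only [h1, Finset.sum_add_distrib, Finset.sum_ite_eq', Finset.sum_const, Nat.card_Ico]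
  rw [if_pos (by simp; omega), if_pos (by simp; omega)]
  simp only [Nat.add_sub_cancel, nsmul_eq_mul]
  have h2 : 0 ≤ (1 / (n : ℝ) * (f (s + 1) - f s)) * (1 / (n : ℝ) * (g (t + 1) - g t)) := by
    have h3 := sub_nonneg.2 (hf (Nat.le_succ s))
    have h4 := sub_nonneg.2 (hg (Nat.le_succ t))
    have h5 : (0 : ℝ) ≤ 1 / n := by positivity
    exact mul_nonneg (mul_nonneg h5 h3) (mul_nonneg h5 h4)
  have h6 : 1 / (n : ℝ) * ((n : ℝ) * (f s * g t) + (f (s + 1) - f s) * g t +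
      f s * (g (t + 1) - g t)) = f s * g t + 1 / (n : ℝ) * ((f (s + 1) - f s) * g t +
      f s * (g (t + 1) - g t)) := by
    field_simp
    ring
  rw [h6]
  nlinarith [h2]

omit [MeasurableSpace Ω] in
theorem finite_range_indegree (M n v : ℕ) :
    (Set.range fun ω => indegree (Q · ω) M n v).Finite :=
  (Set.finite_Iic n).subset (by rintro _ ⟨ω, rfl⟩; exact indegree_le _ _ _ _)

theorem integrable_indegree (hQ : IsUniformParent Q μ) (M n v : ℕ) (f : ℕ → ℝ) :
    Integrable (fun ω => f (indegree (Q · ω) M n v)) μ :=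
  integrable_comp_of_finite_range (hQ.measurable_indegree M n v) (finite_range_indegree M n v) f

theorem integrable_indegree_mul (hQ : IsUniformParent Q μ) (M n v w : ℕ) (f g : ℕ → ℝ) :
    Integrable (fun ω => f (indegree (Q · ω) M n v) * g (indegree (Q · ω) M n w)) μ :=
  integrable_comp_of_finite_range
    (X := fun ω => (indegree (Q · ω) M n v, indegree (Q · ω) M n w))
    ((hQ.measurable_indegree M n v).prodMk (hQ.measurable_indegree M n w))
    (((finite_range_indegree (Q := Q) M n v).prod (finite_range_indegree (Q := Q) M n w)).subset
      (by rintro _ ⟨ω, rfl⟩; exact ⟨⟨ω, rfl⟩, ⟨ω, rfl⟩⟩)) fun x => f x.1 * g x.2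

/-- Vertex `M + i + 1` picks `v` with probability `1 / (M + i)`, independently of the past;
averaging over the last choice gives the Poisson binomial recursion. The law is the same for all `v
≤ M`. -/
theorem integral_indegree (hQ : IsUniformParent Q μ) {M v : ℕ} (hv : 1 ≤ v) (hvM : v ≤ M) (j : ℕ)
    (f : ℕ → ℝ) :
    ∫ ω, f (indegree (Q · ω) M (M + j) v) ∂μ =
      poissonBinomialExp (fun i => 1 / ((M : ℝ) + i)) j f := by
  induction j generalizing f with
  | zero => simp [indegree_self, poissonBinomialExp]
  | succ j ih =>
    rw [poissonBinomialExp, ← ih]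
    have h1 : ∀ ω, indegree (Q · ω) M (M + (j + 1)) v = indegree (Q · ω) M (M + j) v +
        if Q (M + j + 1) ω = v then 1 else 0 := fun ω => indegree_succ _ (Nat.le_add_right M j) v
    simp only [h1]
    rw [hQ.integral_next (n := M + j) (by omega)
      (X := fun ω => indegree (Q · ω) M (M + j) v) (hQ.measurable_indegree _ _ _)
      (finite_range_indegree _ _ _)
      (hQ.indepFun_next (by omega) (fun p => indegree p M (M + j) v)
        fun p q hpq => indegree_congr (fun k hk => hpq k (by omega)) v)
      (fun s i => f (s + if i = v then 1 else 0))]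
    refine integral_congr_ae (Eventually.of_forall fun ω => ?_)
    have := average_single hv (show v ≤ M + j by omega) f (indegree (Q · ω) M (M + j) v)
    simpa only [Nat.cast_add] using this

/-- The in-degrees of two distinct vertices are negatively associated. -/
theorem integral_indegree_mul_le (hQ : IsUniformParent Q μ) {M v w : ℕ} (hv : 1 ≤ v) (hvM : v ≤ M)
    (hw : 1 ≤ w) (hwM : w ≤ M) (hvw : v ≠ w) (j : ℕ) {f g : ℕ → ℝ} (hf : Monotone f)
    (hg : Monotone g) :
    ∫ ω, f (indegree (Q · ω) M (M + j) v) * g (indegree (Q · ω) M (M + j) w) ∂μ ≤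
      poissonBinomialExp (fun i => 1 / ((M : ℝ) + i)) j f *
        poissonBinomialExp (fun i => 1 / ((M : ℝ) + i)) j g := by
  induction j generalizing f g with
  | zero => simp [indegree_self, poissonBinomialExp]
  | succ j ih =>
    have hMj : (1 : ℝ) ≤ (M + j : ℕ) := by exact_mod_cast (by omega : 1 ≤ M + j)
    have hp0 : (0 : ℝ) ≤ 1 / (M + j : ℕ) := by positivity
    have hp1 : 0 ≤ 1 - 1 / ((M + j : ℕ) : ℝ) := by
      rw [sub_nonneg, div_le_one (by linarith)]
      exact hMj
    -- Averaging over one choice preserves monotonicity, so the induction hypothesis applies to the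
    -- averaged functions.
    have hmono : ∀ {f : ℕ → ℝ}, Monotone f → Monotone fun s =>
        (1 - 1 / ((M + j : ℕ) : ℝ)) * f s + 1 / ((M + j : ℕ) : ℝ) * f (s + 1) :=
      fun hf a b hab => add_le_add (mul_le_mul_of_nonneg_left (hf hab) hp1)
        (mul_le_mul_of_nonneg_left (hf (by omega)) hp0)
    simp only [poissonBinomialExp, ← Nat.cast_add]
    have ih' := ih (hmono hf) (hmono hg)
    simp only [← Nat.cast_add] at ih'
    refine le_trans ?_ ih'
    have h1 : ∀ u ω, indegree (Q · ω) M (M + (j + 1)) u = indegree (Q · ω) M (M + j) u +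
        if Q (M + j + 1) ω = u then 1 else 0 := fun u ω => indegree_succ _ (Nat.le_add_right M j) u
    simp only [h1]
    have hm := (hQ.measurable_indegree M (M + j) v).prodMk (hQ.measurable_indegree M (M + j) w)
    have hfin : (Set.range fun ω =>
        (indegree (Q · ω) M (M + j) v, indegree (Q · ω) M (M + j) w)).Finite :=
      ((finite_range_indegree (Q := Q) M (M + j) v).prod
        (finite_range_indegree (Q := Q) M (M + j) w)).subset
        (by rintro _ ⟨ω, rfl⟩; exact ⟨⟨ω, rfl⟩, ⟨ω, rfl⟩⟩)
    rw [hQ.integral_next (n := M + j) (by omega)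
      (X := fun ω => (indegree (Q · ω) M (M + j) v, indegree (Q · ω) M (M + j) w)) hm hfin
      (hQ.indepFun_next (by omega) (fun p => (indegree p M (M + j) v, indegree p M (M + j) w))
        fun p q hpq => Prod.ext (indegree_congr (fun k hk => hpq k (by omega)) v)
          (indegree_congr (fun k hk => hpq k (by omega)) w))
      (fun x i => f (x.1 + if i = v then 1 else 0) * g (x.2 + if i = w then 1 else 0))]
    have hmul := hQ.integrable_indegree_mul M (M + j) v w
      (fun s => (1 - 1 / ((M + j : ℕ) : ℝ)) * f s + 1 / ((M + j : ℕ) : ℝ) * f (s + 1))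
      (fun s => (1 - 1 / ((M + j : ℕ) : ℝ)) * g s + 1 / ((M + j : ℕ) : ℝ) * g (s + 1))
    have hleft := integrable_comp_of_finite_range (μ := μ) hm hfin fun x =>
      1 / ((M + j : ℕ) : ℝ) * ∑ i ∈ Finset.Ico 1 (M + j + 1),
        (f (x.1 + if i = v then 1 else 0) * g (x.2 + if i = w then 1 else 0))
    exact integral_mono hleft hmul fun ω =>
      average_pair_le hv (by omega) hw (by omega) hvw hf hg _ _

end IsUniformParent

/-! ### Lower tail estimate by tilting -/

theorem parentProb_nonneg (M i : ℕ) : (0 : ℝ) ≤ 1 / ((M : ℝ) + i) := by positivity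

theorem parentProb_le_one {M : ℕ} (hM : 1 ≤ M) (i : ℕ) : 1 / ((M : ℝ) + i) ≤ 1 := by
  have : (1 : ℝ) ≤ M := by exact_mod_cast hM
  rw [div_le_one (by positivity)]
  have : (0 : ℝ) ≤ i := by positivity
  linarith

/-- The factors are `(M + i + 1) / (M + i)`, so the product telescopes. -/
theorem prod_doubling {M : ℕ} (hM : 1 ≤ M) (j : ℕ) :
    ∏ i ∈ Finset.range j, (1 - 1 / ((M : ℝ) + i) + 1 / ((M : ℝ) + i) * 2) =
      ((M : ℝ) + j) / M := by
  have hM' : (1 : ℝ) ≤ M := by exact_mod_cast hM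
  induction j with
  | zero => simp [show (M : ℝ) ≠ 0 by linarith]
  | succ j ih =>
    rw [Finset.prod_range_succ, ih]
    push_cast
    field_simp
    ring

/-- A lower bound for the upper tail of the in-degree, by a second moment estimate under the law
tilted by `2`. -/
theorem indegree_tail_ge {M : ℕ} (hM : 1 ≤ M) (j d : ℕ) {m w : ℝ}
    (hm : m = 2 * ∑ i ∈ Finset.range j, 1 / ((M : ℝ) + i + 1)) (hw : 0 < w)
    (hd : (d : ℝ) ≤ m - w) :
    (2 : ℝ) ^ (-(m + w)) * (((M : ℝ) + j) / M) * (1 - m / w ^ 2) ≤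
      poissonBinomialExp (fun i => 1 / ((M : ℝ) + i)) j fun s => if d ≤ s then 1 else 0 := by
  have hM' : (1 : ℝ) ≤ M := by exact_mod_cast hM
  -- The left side is `2 ^ (s - m - w) * (1 - (s - m) ^ 2 / w ^ 2)`: at most `1` on the window `|s -
  -- m| ≤ w`, where `d ≤ s`, and nonpositive outside it.
  have hle : ∀ s : ℕ, (2 : ℝ) ^ (-(m + w)) * 2 ^ s +
      (-((2 : ℝ) ^ (-(m + w)) / w ^ 2)) * (2 ^ s * ((s : ℝ) - m) ^ 2) ≤
        if d ≤ s then 1 else 0 := by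
    intro s
    have h1 : (2 : ℝ) ^ (-(m + w)) * 2 ^ s +
      (-((2 : ℝ) ^ (-(m + w)) / w ^ 2)) * (2 ^ s * ((s : ℝ) - m) ^ 2) =
        (2 : ℝ) ^ ((s : ℝ) - m - w) * (1 - ((s : ℝ) - m) ^ 2 / w ^ 2) := by
      rw [show (s : ℝ) - m - w = -(m + w) + s by ring, Real.rpow_add (by norm_num),
        Real.rpow_natCast]
      ring
    rw [h1]
    have hpos : (0 : ℝ) < 2 ^ ((s : ℝ) - m - w) := by positivity
    rcases le_or_gt |(s : ℝ) - m| w with h | h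
    · rw [abs_le] at h
      have : d ≤ s := by
        have : (d : ℝ) ≤ s := by linarith [h.1]
        exact_mod_cast this
      rw [if_pos this]
      refine mul_le_one₀ (Real.rpow_le_one_of_one_le_of_nonpos (by norm_num) (by linarith [h.2]))
        ?_ ?_
      · rw [sub_nonneg, div_le_one (by positivity)]
        exact sq_le_sq' h.1 h.2
      · have : 0 ≤ ((s : ℝ) - m) ^ 2 / w ^ 2 := by positivity
        linarith
    · have h2 : 1 ≤ ((s : ℝ) - m) ^ 2 / w ^ 2 := by
        rw [one_le_div (by positivity), ← sq_abs ((s : ℝ) - m)]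
        exact pow_le_pow_left₀ hw.le h.le 2
      refine (mul_nonpos_of_nonneg_of_nonpos hpos.le (by linarith)).trans ?_
      split_ifs <;> norm_num
  refine le_trans ?_ (poissonBinomialExp.mono (parentProb_nonneg M) (parentProb_le_one hM) j hle)
  -- Tilting by `2` turns `p = 1 / (M + i)` into `2 * p / (1 + p) = 2 / (M + i + 1)`, so `m` is the
  -- tilted mean and bounds the tilted variance.
  rw [poissonBinomialExp.linear, poissonBinomialExp.tilt,
    poissonBinomialExp.tilt_sq (r := fun i => 2 / ((M : ℝ) + i + 1))
      (fun i => by field_simp; ring), prod_doubling hM]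
  have hsum : ∑ i ∈ Finset.range j, 2 / ((M : ℝ) + i + 1) = m := by
    rw [hm, Finset.mul_sum]
    exact Finset.sum_congr rfl fun i _ => by ring
  have hvar : ∑ i ∈ Finset.range j, 2 / ((M : ℝ) + i + 1) * (1 - 2 / ((M : ℝ) + i + 1)) ≤ m := by
    rw [← hsum]
    refine Finset.sum_le_sum fun i _ => mul_le_of_le_one_right (by positivity) ?_
    have : (0 : ℝ) ≤ 2 / ((M : ℝ) + i + 1) := by positivity
    linarith
  rw [hsum, sub_self, zero_pow two_ne_zero, add_zero]
  have h3 : 0 ≤ (2 : ℝ) ^ (-(m + w)) * (((M : ℝ) + j) / M) / w ^ 2 := by positivity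
  have h4 := mul_le_mul_of_nonneg_left hvar h3
  calc _ = (2 : ℝ) ^ (-(m + w)) * (((M : ℝ) + j) / M) -
        (2 : ℝ) ^ (-(m + w)) * (((M : ℝ) + j) / M) / w ^ 2 * m := by ring
    _ ≤ _ := sub_le_sub_left h4 _
    _ = _ := by ring

/-! ### First and second moment bounds -/

namespace IsUniformParent

variable {Ω : Type*} [MeasurableSpace Ω] {μ : Measure Ω} [IsProbabilityMeasure μ]
  {Q : ℕ → Ω → ℕ}

/-- The trivial tilt `t = 1` gives variance plus squared bias. The variance is at most the mean,
which lies between `ln n` and `ln n + 1`. -/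
theorem integral_root_sq_le (hQ : IsUniformParent Q μ) {n : ℕ} (hn : 1 ≤ n) :
    ∫ ω, ((indegree (Q · ω) 1 n 1 : ℝ) - Real.log n) ^ 2 ∂μ ≤ Real.log n + 2 := by
  obtain ⟨j, rfl⟩ := Nat.exists_eq_add_of_le hn
  have h := hQ.integral_indegree le_rfl le_rfl j
    fun s => (1 : ℝ) ^ s * ((s : ℝ) - Real.log ((1 + j : ℕ) : ℝ)) ^ 2
  rw [poissonBinomialExp.tilt_sq (r := fun i => 1 / (((1 : ℕ) : ℝ) + i))
    (fun i => by ring)] at h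
  simp only [one_pow, one_mul, mul_one, sub_add_cancel, Finset.prod_const_one] at h
  rw [h]
  have h1 := log_le_harmonic_sum le_rfl j
  have h2 := harmonic_sum_le_log le_rfl j
  have h3 : ∑ i ∈ Finset.range j, 1 / (((1 : ℕ) : ℝ) + i) ≤
      ∑ i ∈ Finset.range j, 1 / (((1 : ℕ) : ℝ) + i + 1) + 1 := by
    refine (Finset.sum_le_sum_of_subset_of_nonneg
      (Finset.range_subset_range.2 (Nat.le_succ j)) fun i _ _ => by positivity).trans ?_
    rw [Finset.sum_range_succ']
    simp [add_assoc]
  have h4 : ∑ i ∈ Finset.range j, 1 / (((1 : ℕ) : ℝ) + i) * (1 - 1 / (((1 : ℕ) : ℝ) + i)) ≤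
      ∑ i ∈ Finset.range j, 1 / (((1 : ℕ) : ℝ) + i) := by
    refine Finset.sum_le_sum fun i _ => mul_le_of_le_one_right (by positivity) ?_
    have := parentProb_nonneg 1 i
    linarith
  have h5 : (((1 : ℕ) : ℝ) + j) / ((1 : ℕ) : ℝ) = ((1 + j : ℕ) : ℝ) := by push_cast; ring
  rw [h5] at h1 h2
  generalize ∑ i ∈ Finset.range j, 1 / (((1 : ℕ) : ℝ) + i) = S at *
  nlinarith

theorem measure_root_le (hQ : IsUniformParent Q μ) {n : ℕ} (hn : 1 ≤ n) {x : ℝ} (hx : 0 < x) :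
    μ.real {ω | x ≤ |(indegree (Q · ω) 1 n 1 : ℝ) - Real.log n|} ≤ (Real.log n + 2) / x ^ 2 := by
  have h1 := mul_meas_ge_le_integral_of_nonneg (μ := μ)
    (f := fun ω => ((indegree (Q · ω) 1 n 1 : ℝ) - Real.log n) ^ 2)
    (Eventually.of_forall fun ω => sq_nonneg _)
    (hQ.integrable_indegree 1 n 1 fun s => ((s : ℝ) - Real.log n) ^ 2) (x ^ 2)
  rw [le_div_iff₀' (by positivity)]
  refine le_trans ?_ (h1.trans (hQ.integral_root_sq_le hn))
  refine mul_le_mul_of_nonneg_left (measureReal_mono fun ω hω => ?_) (by positivity)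
  have hω' : x ≤ |(indegree (Q · ω) 1 n 1 : ℝ) - Real.log n| := hω
  show x ^ 2 ≤ ((indegree (Q · ω) 1 n 1 : ℝ) - Real.log n) ^ 2
  rw [← sq_abs ((indegree (Q · ω) 1 n 1 : ℝ) - Real.log n)]
  exact pow_le_pow_left₀ hx.le hω' 2

theorem integral_two_pow_indegree (hQ : IsUniformParent Q μ) {n v : ℕ} (hv : 1 ≤ v) (hvn : v ≤ n) :
    ∫ ω, (2 : ℝ) ^ indegree (Q · ω) v n v ∂μ = n / v := by
  obtain ⟨j, rfl⟩ := Nat.exists_eq_add_of_le hvn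
  rw [hQ.integral_indegree hv le_rfl j fun s => (2 : ℝ) ^ s, poissonBinomialExp.tilt,
    prod_doubling hv]
  push_cast
  rfl

/-- Markov's inequality for `∑ 2 ^ deg v`, whose mean is `n` times the harmonic number; it dominates
`2 ^ d * Z_{≥ d}`. -/
theorem measure_numDegreeGE_ge_le (hQ : IsUniformParent Q μ) {n : ℕ} (hn : 1 ≤ n) (d : ℕ) {x : ℝ}
    (hx : 0 < x) :
    μ.real {ω | x ≤ (recursiveTree (Q · ω) n).numDegreeGE d} ≤
      n * (1 + Real.log n) / (2 ^ d * x) := by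
  let W : Ω → ℝ := fun ω => ∑ v ∈ Finset.Icc 1 n, (2 : ℝ) ^ indegree (Q · ω) v n v
  have hZW : ∀ ω, (2 : ℝ) ^ d * (recursiveTree (Q · ω) n).numDegreeGE d ≤ W ω := by
    intro ω
    rw [recursiveTree_numDegreeGE, Finset.card_filter, Nat.cast_sum, Finset.mul_sum]
    refine Finset.sum_le_sum fun v hv => ?_
    rw [indegree_one_eq (fun k hk => (Finset.mem_Ico.1 (hQ.mem k hk ω)).2) (Finset.mem_Icc.1 hv).1]
    split_ifs with h
    · simpa using pow_le_pow_right₀ (by norm_num : (1 : ℝ) ≤ 2) h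
    · simp
  have hint : ∀ v, Integrable (fun ω => (2 : ℝ) ^ indegree (Q · ω) v n v) μ := fun v =>
    hQ.integrable_indegree v n v fun s => (2 : ℝ) ^ s
  have hW : ∫ ω, W ω ∂μ ≤ n * (1 + Real.log n) := by
    simp only [W]
    rw [integral_finsetSum _ fun v _ => hint v]
    have h1 : ∑ v ∈ Finset.Icc 1 n, ∫ ω, (2 : ℝ) ^ indegree (Q · ω) v n v ∂μ =
        n * ((harmonic n : ℚ) : ℝ) := by
      rw [harmonic_eq_sum_Icc, Rat.cast_sum, Finset.mul_sum]
      refine Finset.sum_congr rfl fun v hv => ?_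
      rw [Finset.mem_Icc] at hv
      rw [hQ.integral_two_pow_indegree hv.1 hv.2]
      push_cast
      rfl
    rw [h1]
    exact mul_le_mul_of_nonneg_left (harmonic_le_one_add_log n) (by positivity)
  have h2 := mul_meas_ge_le_integral_of_nonneg (μ := μ) (f := W)
    (Eventually.of_forall fun ω => Finset.sum_nonneg fun v _ => by positivity)
    (integrable_finsetSum _ fun v _ => hint v) (2 ^ d * x)
  rw [le_div_iff₀' (by positivity)]
  refine le_trans ?_ (h2.trans hW)
  refine mul_le_mul_of_nonneg_left (measureReal_mono fun ω hω => ?_) (by positivity)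
  have hω' : x ≤ (recursiveTree (Q · ω) n).numDegreeGE d := hω
  exact (mul_le_mul_of_nonneg_left hω' (by positivity)).trans (hZW ω)

/-- The second moment method for the number of early vertices of large degree. -/
theorem measure_numDegreeGE_le (hQ : IsUniformParent Q μ) {M : ℕ} (hM : 1 ≤ M) (j d : ℕ) {q : ℝ}
    (hq : q = poissonBinomialExp (fun i => 1 / ((M : ℝ) + i)) j fun s => if d ≤ s then 1 else 0)
    (hq0 : 0 < q) :
    μ.real {ω | ((recursiveTree (Q · ω) (M + j)).numDegreeGE d : ℝ) ≤ M * q / 2} ≤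
      4 / (M * q) := by
  have hM' : (1 : ℝ) ≤ M := by exact_mod_cast hM
  let g : ℕ → ℝ := fun s => if d ≤ s then 1 else 0
  have hg : Monotone g := by
    intro a b hab
    simp only [g]
    split_ifs
    · exact le_rfl
    · omega
    · norm_num
    · exact le_rfl
  let X : ℕ → Ω → ℝ := fun v ω => g (indegree (Q · ω) M (M + j) v)
  let Z : Ω → ℝ := fun ω => ∑ v ∈ Finset.Icc 1 M, X v ω
  -- `Z` ignores vertices above `M` and edges from vertices up to `M`; this loses degree but makes
  -- the counted vertices identically distributed.
  have hZ : ∀ ω, Z ω ≤ (recursiveTree (Q · ω) (M + j)).numDegreeGE d := by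
    intro ω
    rw [recursiveTree_numDegreeGE, Finset.card_filter, Nat.cast_sum]
    refine (Finset.sum_le_sum fun v _ => ?_).trans (Finset.sum_le_sum_of_subset_of_nonneg
      (Finset.Icc_subset_Icc_right (Nat.le_add_right M j)) fun _ _ _ => by positivity)
    refine (hg (indegree_anti (Q · ω) hM (M + j) v)).trans (le_of_eq ?_)
    simp [g]
  have hXi : ∀ v, Integrable (X v) μ := fun v => hQ.integrable_indegree _ _ _ g
  have hXXi : ∀ v w, Integrable (fun ω => X v ω * X w ω) μ := fun v w =>
    hQ.integrable_indegree_mul _ _ _ _ g g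
  have hX : ∀ v ∈ Finset.Icc 1 M, ∫ ω, X v ω ∂μ = q := by
    intro v hv
    rw [Finset.mem_Icc] at hv
    rw [hq]
    exact hQ.integral_indegree hv.1 hv.2 j g
  have hXX : ∀ v ∈ Finset.Icc 1 M, ∀ w ∈ Finset.Icc 1 M,
      ∫ ω, X v ω * X w ω ∂μ ≤ q ^ 2 + if v = w then q else 0 := by
    intro v hv w hw
    split_ifs with h
    · subst h
      have : ∀ ω, X v ω * X v ω = X v ω := by
        intro ω
        simp only [X, g]
        split_ifs <;> simp
      simp only [this, hX v hv]
      nlinarith [sq_nonneg q]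
    · rw [Finset.mem_Icc] at hv hw
      rw [add_zero, sq, hq]
      exact hQ.integral_indegree_mul_le hv.1 hv.2 hw.1 hw.2 h j hg hg
  have hZi : Integrable Z μ := integrable_finsetSum _ fun v _ => hXi v
  have hZsq : ∀ ω, Z ω ^ 2 = ∑ v ∈ Finset.Icc 1 M, ∑ w ∈ Finset.Icc 1 M, X v ω * X w ω := by
    intro ω
    rw [sq, Finset.sum_mul_sum]
  have hZZi : Integrable (fun ω => Z ω ^ 2) μ := by
    simp only [hZsq]
    exact integrable_finsetSum _ fun v _ => integrable_finsetSum _ fun w _ => hXXi v w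
  have hEZ : ∫ ω, Z ω ∂μ = M * q := by
    simp only [Z]
    rw [integral_finsetSum _ fun v _ => hXi v, Finset.sum_congr rfl hX]
    simp
  have hEZZ : ∫ ω, Z ω ^ 2 ∂μ ≤ (M * q) ^ 2 + M * q := by
    simp only [hZsq]
    rw [integral_finsetSum _ fun v _ => integrable_finsetSum _ fun w _ => hXXi v w]
    have : ∀ v ∈ Finset.Icc 1 M, ∫ ω, ∑ w ∈ Finset.Icc 1 M, X v ω * X w ω ∂μ ≤
        M * q ^ 2 + q := by
      intro v hv
      rw [integral_finsetSum _ fun w _ => hXXi v w]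
      refine (Finset.sum_le_sum fun w hw => hXX v hv w hw).trans (le_of_eq ?_)
      rw [Finset.sum_add_distrib, Finset.sum_ite_eq, if_pos hv]
      simp
    refine (Finset.sum_le_sum this).trans (le_of_eq ?_)
    simp
    ring
  have hvar : ∫ ω, (Z ω - M * q) ^ 2 ∂μ ≤ M * q := by
    have h1 : ∀ ω, (Z ω - M * q) ^ 2 = Z ω ^ 2 - 2 * (M * q) * Z ω + (M * q) ^ 2 :=
      fun ω => by ring
    simp only [h1]
    have h2 : Integrable (fun ω => Z ω ^ 2 - 2 * (M * q) * Z ω) μ := hZZi.sub (hZi.const_mul _)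
    rw [integral_add h2 (integrable_const _),
      integral_sub hZZi (hZi.const_mul _), integral_const_mul, hEZ]
    simp only [integral_const, probReal_univ, one_smul]
    nlinarith
  have hvi : Integrable (fun ω => (Z ω - M * q) ^ 2) μ := by
    have h1 : ∀ ω, (Z ω - M * q) ^ 2 = Z ω ^ 2 - 2 * (M * q) * Z ω + (M * q) ^ 2 :=
      fun ω => by ring
    simp only [h1]
    exact (hZZi.sub (hZi.const_mul _)).add (integrable_const _)
  have hMq : 0 < M * q := by positivity
  have h2 := (mul_meas_ge_le_integral_of_nonneg (μ := μ)
    (f := fun ω => (Z ω - M * q) ^ 2) (Eventually.of_forall fun ω => sq_nonneg _) hvi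
      ((M * q / 2) ^ 2)).trans hvar
  -- On this event `Z` is at least `M * q / 2` below its mean `M * q`; as its variance is at most `M
  -- * q`, Chebyshev gives `4 / (M * q)`.
  have h3 : μ.real {ω | ((recursiveTree (Q · ω) (M + j)).numDegreeGE d : ℝ) ≤ M * q / 2} ≤
      μ.real {ω | (M * q / 2) ^ 2 ≤ (Z ω - M * q) ^ 2} := by
    refine measureReal_mono fun ω hω => ?_
    have hω' : ((recursiveTree (Q · ω) (M + j)).numDegreeGE d : ℝ) ≤ M * q / 2 := hω
    have := (hZ ω).trans hω'
    show (M * q / 2) ^ 2 ≤ (Z ω - M * q) ^ 2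
    nlinarith
  refine h3.trans ?_
  rw [le_div_iff₀ hMq]
  nlinarith

end IsUniformParent

/-! ### Asymptotics and conclusion -/

theorem tendsto_log_natCast_atTop : Tendsto (fun n : ℕ => Real.log n) atTop atTop :=
  Real.tendsto_log_atTop.comp tendsto_natCast_atTop_atTop

theorem two_rpow_mul_log {x : ℝ} (hx : 0 < x) (b : ℝ) :
    (2 : ℝ) ^ (b * Real.log x) = x ^ (b * Real.log 2) := by
  rw [Real.rpow_def_of_pos (by norm_num), Real.rpow_def_of_pos hx]
  ring_nf

/-- With `M` about `n ^ (1/2 - δ)` the tilted mean is about `(1 + 2 * δ) * ln n`, just above the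
degree threshold. In the final bound `M` cancels against the factor `n / M`, leaving only the power
of `2`. -/
theorem eventually_exists_expected_ge {δ : ℝ} (hδ0 : 0 < δ) (hδ1 : δ ≤ 1 / 10) :
    ∀ᶠ n : ℕ in atTop, ∃ M j : ℕ, 1 ≤ M ∧ M + j = n ∧
      (n : ℝ) ^ (1 - (1 + 5 / 2 * δ) * Real.log 2) / 2 ≤
        M * poissonBinomialExp (fun i => 1 / ((M : ℝ) + i)) j
          fun s => if ⌈(1 + δ) * Real.log n⌉₊ ≤ s then 1 else 0 := by
  filter_upwards [tendsto_log_natCast_atTop.eventually_ge_atTop (10 / δ ^ 2),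
    eventually_ge_atTop 2] with n hL hn
  have hn1 : (1 : ℝ) ≤ n := by exact_mod_cast (by omega : 1 ≤ n)
  have hn0 : (0 : ℝ) < n := by linarith
  set L := Real.log n with hLdef
  set a : ℝ := 1 / 2 - δ with ha
  have hL1 : 10 ≤ δ ^ 2 * L := by
    rwa [div_le_iff₀' (by positivity)] at hL
  have hL0 : 0 < L := lt_of_lt_of_le (by positivity) hL
  have hL2 : 10 ≤ δ * L := by nlinarith [mul_pos hδ0 hL0]
  have hna : 1 ≤ (n : ℝ) ^ a := Real.one_le_rpow hn1 (by linarith)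
  set M := ⌈(n : ℝ) ^ a⌉₊ with hMdef
  have hM : 1 ≤ M := Nat.one_le_ceil_iff.2 (by linarith)
  have hMn : M ≤ n := by
    refine Nat.ceil_le.2 ?_
    calc (n : ℝ) ^ a ≤ (n : ℝ) ^ (1 : ℝ) := Real.rpow_le_rpow_of_exponent_le hn1 (by linarith)
      _ = n := Real.rpow_one _
  have hMge : (n : ℝ) ^ a ≤ M := Nat.le_ceil _
  have hMle : (M : ℝ) + 1 ≤ 3 * (n : ℝ) ^ a := by
    have := (Nat.ceil_lt_add_one (by linarith : 0 ≤ (n : ℝ) ^ a)).le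
    linarith
  have hM0 : (0 : ℝ) < M := by linarith
  have hloga : Real.log ((n : ℝ) ^ a) = a * L := Real.log_rpow hn0 a
  obtain ⟨j, hj⟩ := Nat.exists_eq_add_of_le hMn
  have hjR : (M : ℝ) + j = n := by exact_mod_cast hj.symm
  refine ⟨M, j, hM, hj.symm, ?_⟩
  have h1 := harmonic_sum_le_log hM j
  -- The tilted denominators start at `M + 1`.
  have h2 := log_le_harmonic_sum (M := M + 1) (by omega) j
  have h2' : ∑ i ∈ Finset.range j, 1 / (((M + 1 : ℕ) : ℝ) + i) =
      ∑ i ∈ Finset.range j, 1 / ((M : ℝ) + i + 1) :=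
    Finset.sum_congr rfl fun i _ => by push_cast; ring_nf
  rw [h2'] at h2
  obtain ⟨m, hm⟩ : ∃ m, m = 2 * ∑ i ∈ Finset.range j, 1 / ((M : ℝ) + i + 1) := ⟨_, rfl⟩
  have hmle : m ≤ (1 + 2 * δ) * L := by
    have h3 : Real.log (((M : ℝ) + j) / M) ≤ (1 - a) * L := by
      rw [hjR, Real.log_div hn0.ne' hM0.ne']
      have := Real.log_le_log (by linarith) hMge
      rw [hloga] at this
      linarith
    rw [hm]
    have : (1 + 2 * δ) * L = 2 * ((1 - a) * L) := by rw [ha]; ring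
    linarith
  have hmge : (1 + 2 * δ) * L - 4 ≤ m := by
    have h3 : (1 - a) * L - 2 ≤ Real.log ((((M + 1 : ℕ) : ℝ) + j) / ((M + 1 : ℕ) : ℝ)) := by
      have h4 : ((M + 1 : ℕ) : ℝ) + j = n + 1 := by push_cast; linarith
      rw [h4, Real.log_div (by positivity) (by positivity)]
      have h5 : Real.log ((M + 1 : ℕ) : ℝ) ≤ a * L + 2 := by
        have h6 := Real.log_le_log (by positivity) hMle
        rw [Real.log_mul (by norm_num) (by positivity), hloga] at h6
        have h7 : Real.log 3 ≤ 3 - 1 := Real.log_le_sub_one_of_pos (by norm_num)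
        push_cast
        linarith
      have h8 : L ≤ Real.log ((n : ℝ) + 1) := Real.log_le_log hn0 (by linarith)
      linarith
    rw [hm]
    have : (1 + 2 * δ) * L = 2 * ((1 - a) * L) := by rw [ha]; ring
    linarith
  -- The error `4` in `hmge` and the rounding error `1` fit into `δ * L / 2` because `δ * L ≥ 10`.
  have hd : ((⌈(1 + δ) * L⌉₊ : ℕ) : ℝ) ≤ m - δ * L / 2 := by
    have := (Nat.ceil_lt_add_one (by positivity : 0 ≤ (1 + δ) * L)).le
    linarith
  have htail := indegree_tail_ge hM j ⌈(1 + δ) * L⌉₊ hm (w := δ * L / 2) (by positivity) hd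
  -- As `m ≤ 1.2 * L`, the quotient is at most `4.8 / (δ ^ 2 * L)`, and `δ ^ 2 * L ≥ 10`.
  have hhalf : 1 / 2 ≤ 1 - m / (δ * L / 2) ^ 2 := by
    have : m / (δ * L / 2) ^ 2 ≤ 1 / 2 := by
      rw [div_le_iff₀ (by positivity)]
      nlinarith
    linarith
  have hpow : (n : ℝ) ^ (-((1 + 5 / 2 * δ) * Real.log 2)) ≤ 2 ^ (-(m + δ * L / 2)) := by
    rw [← neg_mul, ← two_rpow_mul_log hn0]
    exact Real.rpow_le_rpow_of_exponent_le (by norm_num) (by linarith)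
  calc (n : ℝ) ^ (1 - (1 + 5 / 2 * δ) * Real.log 2) / 2
      = M * ((n : ℝ) ^ (-((1 + 5 / 2 * δ) * Real.log 2)) * (((M : ℝ) + j) / M) * (1 / 2)) := by
        rw [hjR, sub_eq_add_neg, Real.rpow_add hn0, Real.rpow_one]
        field_simp
    _ ≤ M * ((2 : ℝ) ^ (-(m + δ * L / 2)) * (((M : ℝ) + j) / M) *
          (1 - m / (δ * L / 2) ^ 2)) := by
        gcongr
    _ ≤ _ := mul_le_mul_of_nonneg_left htail hM0.le

namespace IsUniformParent

variable {Ω : Type*} [MeasurableSpace Ω] {μ : Measure Ω} [IsProbabilityMeasure μ]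
  {Q : ℕ → Ω → ℕ}

/-- The root has degree `(1 + o(1)) ln n`. -/
theorem tendsto_measure_root (hQ : IsUniformParent Q μ) {δ : ℝ} (hδ : 0 < δ) :
    Tendsto (fun n : ℕ => μ.real {ω | δ * Real.log n ≤
      |(indegree (Q · ω) 1 n 1 : ℝ) - Real.log n|}) atTop (𝓝 0) := by
  have hlim : Tendsto (fun n : ℕ => 3 / δ ^ 2 * (Real.log n)⁻¹) atTop (𝓝 0) := by
    simpa using (tendsto_inv_atTop_zero.comp tendsto_log_natCast_atTop).const_mul (3 / δ ^ 2)
  refine squeeze_zero' (Eventually.of_forall fun n => measureReal_nonneg) ?_ hlim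
  filter_upwards [tendsto_log_natCast_atTop.eventually_ge_atTop 1, eventually_ge_atTop 1]
    with n hL hn
  have hL0 : 0 < Real.log n := by linarith
  refine (hQ.measure_root_le hn (mul_pos hδ hL0)).trans ?_
  rw [div_le_iff₀ (by positivity)]
  have : 3 / δ ^ 2 * (Real.log n)⁻¹ * (δ * Real.log n) ^ 2 = 3 * Real.log n := by
    field_simp
  linarith

theorem tendsto_measure_upper (hQ : IsUniformParent Q μ) {δ : ℝ} (hδ : 0 < δ) :
    Tendsto (fun n : ℕ => μ.real {ω | (n : ℝ) ^ (1 - Real.log 2 + 2 * δ) ≤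
      (recursiveTree (Q · ω) n).numDegreeGE ⌈(1 - δ) * Real.log n⌉₊}) atTop (𝓝 0) := by
  have hlim : Tendsto (fun n : ℕ => 2 * (Real.log n / (n : ℝ) ^ δ)) atTop (𝓝 0) := by
    simpa using ((isLittleO_log_rpow_atTop hδ).tendsto_div_nhds_zero.comp
      tendsto_natCast_atTop_atTop).const_mul 2
  refine squeeze_zero' (Eventually.of_forall fun n => measureReal_nonneg) ?_ hlim
  filter_upwards [tendsto_log_natCast_atTop.eventually_ge_atTop 1, eventually_ge_atTop 1]
    with n hL hn
  have hn1 : (1 : ℝ) ≤ n := by exact_mod_cast hn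
  have hn0 : (0 : ℝ) < n := by linarith
  refine (hQ.measure_numDegreeGE_ge_le hn _ (by positivity)).trans ?_
  have h1 : (n : ℝ) ^ ((1 - δ) * Real.log 2) ≤ 2 ^ ⌈(1 - δ) * Real.log n⌉₊ := by
    rw [← two_rpow_mul_log hn0, ← Real.rpow_natCast]
    exact Real.rpow_le_rpow_of_exponent_le (by norm_num) (Nat.le_ceil _)
  have hlog2 : Real.log 2 ≤ 1 := by linarith [Real.log_two_lt_d9]
  -- The exponents compare because `δ * ln 2 ≤ δ`; the spare factor `n ^ δ` absorbs the logarithm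
  -- from the harmonic sum.
  have h2 : (n : ℝ) * (n : ℝ) ^ δ ≤
      2 ^ ⌈(1 - δ) * Real.log n⌉₊ * (n : ℝ) ^ (1 - Real.log 2 + 2 * δ) := by
    calc (n : ℝ) * (n : ℝ) ^ δ = (n : ℝ) ^ (1 + δ) := by rw [Real.rpow_add hn0, Real.rpow_one]
      _ ≤ (n : ℝ) ^ ((1 - δ) * Real.log 2 + (1 - Real.log 2 + 2 * δ)) :=
        Real.rpow_le_rpow_of_exponent_le hn1 (by nlinarith)
      _ = (n : ℝ) ^ ((1 - δ) * Real.log 2) * (n : ℝ) ^ (1 - Real.log 2 + 2 * δ) :=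
        Real.rpow_add hn0 _ _
      _ ≤ _ := mul_le_mul_of_nonneg_right h1 (by positivity)
  calc _ ≤ n * (1 + Real.log n) / (n * (n : ℝ) ^ δ) :=
        div_le_div_of_nonneg_left (by positivity) (by positivity) h2
    _ = (1 + Real.log n) / (n : ℝ) ^ δ := by field_simp
    _ ≤ (2 * Real.log n) / (n : ℝ) ^ δ :=
        div_le_div_of_nonneg_right (by linarith) (by positivity)
    _ = _ := by ring

theorem tendsto_measure_lower (hQ : IsUniformParent Q μ) {δ : ℝ} (hδ0 : 0 < δ)
    (hδ1 : δ ≤ 1 / 10) :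
    Tendsto (fun n : ℕ => μ.real {ω |
      ((recursiveTree (Q · ω) n).numDegreeGE ⌈(1 + δ) * Real.log n⌉₊ : ℝ) ≤
        (n : ℝ) ^ (1 - (1 + 5 / 2 * δ) * Real.log 2) / 4}) atTop (𝓝 0) := by
  -- Here `δ ≤ 1 / 10` matters: `1.25 * ln 2 < 1`.
  have hγ : 0 < 1 - (1 + 5 / 2 * δ) * Real.log 2 := by nlinarith [Real.log_two_lt_d9]
  have hlim : Tendsto (fun n : ℕ => 8 * ((n : ℝ) ^ (1 - (1 + 5 / 2 * δ) * Real.log 2))⁻¹)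
      atTop (𝓝 0) := by
    simpa using (tendsto_inv_atTop_zero.comp
      ((tendsto_rpow_atTop hγ).comp tendsto_natCast_atTop_atTop)).const_mul 8
  refine squeeze_zero' (Eventually.of_forall fun n => measureReal_nonneg) ?_ hlim
  filter_upwards [eventually_exists_expected_ge hδ0 hδ1, eventually_ge_atTop 1] with n h hn
  obtain ⟨M, j, hM, hj, hMq⟩ := h
  have hn0 : (0 : ℝ) < n := by exact_mod_cast hn
  have hM0 : (0 : ℝ) < M := by exact_mod_cast hM
  generalize ⌈(1 + δ) * Real.log n⌉₊ = d at *
  generalize hy : (n : ℝ) ^ (1 - (1 + 5 / 2 * δ) * Real.log 2) = y at *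
  have hy0 : 0 < y := by rw [← hy]; positivity
  obtain ⟨q, hq⟩ : ∃ q, q = poissonBinomialExp (fun i => 1 / ((M : ℝ) + i)) j
    fun s => if d ≤ s then 1 else 0 := ⟨_, rfl⟩
  rw [← hq] at hMq
  have hq0 : 0 < q := pos_of_mul_pos_right (lt_of_lt_of_le (by positivity) hMq) hM0.le
  have h1 := hQ.measure_numDegreeGE_le hM j d hq hq0
  rw [hj] at h1
  refine (measureReal_mono fun ω hω => ?_).trans (h1.trans ?_)
  · have hω' : ((recursiveTree (Q · ω) n).numDegreeGE d : ℝ) ≤ y / 4 := hω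
    show ((recursiveTree (Q · ω) n).numDegreeGE d : ℝ) ≤ M * q / 2
    linarith
  · rw [div_le_iff₀ (by positivity)]
    have : 8 * y⁻¹ * (y / 2) = 4 := by field_simp; norm_num
    calc (4 : ℝ) = 8 * y⁻¹ * (y / 2) := this.symm
      _ ≤ _ := mul_le_mul_of_nonneg_left hMq (by positivity)

theorem tendstoInMeasure_log_numDegreeGE (hQ : IsUniformParent Q μ) :
    TendstoInMeasure μ
      (fun n ω => Real.log ((recursiveTree (Q · ω) n).numDegreeGE
        ((recursiveTree (Q · ω) n).degree 1)) / Real.log n)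
      atTop (fun _ => 1 - Real.log 2) := by
  rw [tendstoInMeasure_iff_measureReal_dist]
  intro ε hε
  obtain ⟨δ, hδ0, hδ1, hδε⟩ : ∃ δ : ℝ, 0 < δ ∧ δ ≤ 1 / 10 ∧ 3 * δ ≤ ε :=
    ⟨min (1 / 10) (ε / 3), by positivity, min_le_left _ _, by
      have := min_le_right (1 / 10) (ε / 3)
      linarith⟩
  have hlim := ((hQ.tendsto_measure_root hδ0).add (hQ.tendsto_measure_upper hδ0)).add
    (hQ.tendsto_measure_lower hδ0 hδ1)
  rw [add_zero, add_zero] at hlim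
  refine squeeze_zero' (Eventually.of_forall fun n => measureReal_nonneg) ?_ hlim
  -- This makes the factor `1 / 4` of the lower bound cost at most `δ / 2` in the exponent. With `5
  -- / 2 * ln 2 * δ` the total stays below `3 * δ`; the upper bound costs `2 * δ`.
  filter_upwards [tendsto_log_natCast_atTop.eventually_ge_atTop (2 * Real.log 4 / δ),
    eventually_ge_atTop 2] with n hL hn
  have hn1 : (1 : ℝ) < n := by exact_mod_cast hn
  have hn0 : (0 : ℝ) < n := by linarith
  have hL0 : 0 < Real.log n := Real.log_pos hn1
  rw [div_le_iff₀' hδ0] at hL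
  refine (measureReal_mono ?_).trans ((measureReal_union_le _ _).trans
    (add_le_add_left (measureReal_union_le _ _) _))
  intro ω hω
  by_contra hcon
  rw [Set.mem_union, Set.mem_union, not_or, not_or] at hcon
  obtain ⟨⟨hroot, hup⟩, hlow⟩ := hcon
  replace hroot : |(indegree (Q · ω) 1 n 1 : ℝ) - Real.log n| < δ * Real.log n := not_le.1 hroot
  replace hup : ((recursiveTree (Q · ω) n).numDegreeGE ⌈(1 - δ) * Real.log n⌉₊ : ℝ) <
    (n : ℝ) ^ (1 - Real.log 2 + 2 * δ) := not_le.1 hup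
  replace hlow : (n : ℝ) ^ (1 - (1 + 5 / 2 * δ) * Real.log 2) / 4 <
    ((recursiveTree (Q · ω) n).numDegreeGE ⌈(1 + δ) * Real.log n⌉₊ : ℝ) := not_le.1 hlow
  replace hω : ε ≤ dist (Real.log ((recursiveTree (Q · ω) n).numDegreeGE
        ((recursiveTree (Q · ω) n).degree 1)) / Real.log n) (1 - Real.log 2) := hω
  rw [← recursiveTree_degree, abs_lt] at hroot
  have hd1 : ⌈(1 - δ) * Real.log n⌉₊ ≤ (recursiveTree (Q · ω) n).degree 1 :=
    Nat.ceil_le.2 (by linarith [hroot.1])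
  have hd2 : (recursiveTree (Q · ω) n).degree 1 ≤ ⌈(1 + δ) * Real.log n⌉₊ := by
    have h1 := Nat.le_ceil ((1 + δ) * Real.log n)
    have : ((recursiveTree (Q · ω) n).degree 1 : ℝ) ≤ (⌈(1 + δ) * Real.log n⌉₊ : ℕ) := by
      linarith [hroot.2]
    exact_mod_cast this
  have hz1 : ((recursiveTree (Q · ω) n).numDegreeGE ((recursiveTree (Q · ω) n).degree 1) : ℝ) <
      (n : ℝ) ^ (1 - Real.log 2 + 2 * δ) :=
    lt_of_le_of_lt (Nat.cast_le.2 (LabelledDigraph.numDegreeGE_anti _ hd1)) hup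
  have hz2 : (n : ℝ) ^ (1 - (1 + 5 / 2 * δ) * Real.log 2) / 4 <
      ((recursiveTree (Q · ω) n).numDegreeGE ((recursiveTree (Q · ω) n).degree 1) : ℝ) :=
    lt_of_lt_of_le hlow (Nat.cast_le.2 (LabelledDigraph.numDegreeGE_anti _ hd2))
  generalize ((recursiveTree (Q · ω) n).numDegreeGE
    ((recursiveTree (Q · ω) n).degree 1) : ℝ) = z at *
  have hpos : 0 < (n : ℝ) ^ (1 - (1 + 5 / 2 * δ) * Real.log 2) / 4 := by positivity
  have hl1 := Real.log_lt_log (hpos.trans hz2) hz1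
  have hl2 := Real.log_lt_log hpos hz2
  rw [Real.log_rpow hn0] at hl1
  rw [Real.log_div (by positivity) (by norm_num), Real.log_rpow hn0] at hl2
  refine absurd hω (not_le.2 (lt_of_lt_of_le ?_ hδε))
  rw [Real.dist_eq, abs_lt, lt_sub_iff_add_lt, sub_lt_iff_lt_add, lt_div_iff₀ hL0, div_lt_iff₀ hL0]
  have hδL : 0 < δ * Real.log n := mul_pos hδ0 hL0
  constructor
  · have : (1 - (1 + 5 / 2 * δ) * Real.log 2) * Real.log n =
        (1 - Real.log 2) * Real.log n - 5 / 2 * Real.log 2 * (δ * Real.log n) := by ring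
    nlinarith [Real.log_two_lt_d9]
  · nlinarith

end IsUniformParent

/-- With `Tₙ` the random recursive tree of size `n` and `D` the degree of its root `1`,
`ln Z_{≥ D} / ln n` converges to `1 - ln 2` in probability. -/
theorem theorem1p2 {Ω : Type*} [MeasurableSpace Ω] (μ : Measure Ω) [IsProbabilityMeasure μ]
    (P : ℕ → Ω → ℕ) (hP : IsRecursiveChoice P μ)
    (T : ℕ → Ω → LabelledDigraph) (hT : ∀ n ω, T n ω = recursiveTree (fun i => P i ω) n)
    (D : ℕ → Ω → ℕ) (hD : ∀ n ω, D n ω = (T n ω).degree 1) :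
    TendstoInMeasure μ
      (fun n ω => Real.log ((T n ω).numDegreeGE (D n ω)) / Real.log n)
      atTop (fun _ => 1 - Real.log 2) := by
  obtain ⟨Q, hQ, hPQ⟩ := hP.exists_isUniformParent
  refine hQ.tendstoInMeasure_log_numDegreeGE.congr_left fun n => ?_
  filter_upwards [hPQ] with ω hω
  rw [hD, hT, recursiveTree_congr hω]
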